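/- Let $\kappa$ be a regular uncountable cardinal. For a set $S$, let $\Sigma_\kappa(S)$ be the set of all $x\in[0,1]^S$ such that $|\{\alpha\in S : x(\alpha)\neq 0\}|<\kappa$, with the topology of pointwise convergence. A compact space is called $\kappa$-Corson if it embeds topologically into $\Sigma_\kappa(S)$ for some set $S$. A space is called $\kappa$-Valdivia compact if it is homeomorphic to a closed subspace $C$ of a cube $[0,1]^S$, for some set $S$, such that $C\cap\Sigma_\kappa(S)$ is dense in $C$. A topological space $X$ has local tightness $<\kappa$ if for every $A\subseteq X$ and every $p\in\overline{A}$, the least cardinality of a set $B\subseteq A$ with $p\in\overline{B}$ is less than $\kappa$. Let $K$ be a Hausdorff space that is a continuous image of a $\kappa$-Valdivia compact space. Then $K$ is $\kappa$-Corson if and only if $K$ has local tightness $<\kappa$. -/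

import Mathlib

universe u

open Cardinal Topology

/-- `Σ_κ(S)`: the points of the cube `[0,1]^S` whose support has cardinality less than `κ`.
As a subtype it carries the topology of pointwise convergence. -/
def SigmaProduct (κ : Cardinal.{u}) (S : Type u) : Set (S → unitInterval) :=
  {x | #(Function.support x) < κ}

/-- `K` is a `κ`-Corson compact space: it is compact and embeds topologically in some `Σ_κ(S)`.
(Restricting `S` to the universe of `K` loses nothing: repeated coordinate functions
can be discarded.) -/
def IsKappaCorson (κ : Cardinal.{u}) (K : Type u) [TopologicalSpace K] : Prop :=
  CompactSpace K ∧ ∃ (S : Type u) (e : K → SigmaProduct κ S), IsEmbedding e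

/-- `L` is `κ`-Valdivia compact: it is homeomorphic to a closed subspace `C` of some cube
`[0,1]^S` such that `C ∩ Σ_κ(S)` is dense in `C`. -/
def IsKappaValdivia (κ : Cardinal.{u}) (L : Type u) [TopologicalSpace L] : Prop :=
  ∃ (S : Type u) (C : Set (S → unitInterval)),
    IsClosed C ∧ Dense {x : C | (x : S → unitInterval) ∈ SigmaProduct κ S} ∧ Nonempty (L ≃ₜ C)

/-- `t(p, A)`: the least cardinality of a subset `B` of `A` with `p` in the closure of `B`
(meaningful when `p` lies in the closure of `A`). -/
noncomputable def localTightness {X : Type u} [TopologicalSpace X] (p : X) (A : Set X) :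
    Cardinal.{u} :=
  sInf ((fun B : Set X => #B) '' {B | B ⊆ A ∧ p ∈ closure B})

/-- `X` has local tightness `< κ`. -/
def HasLocalTightnessLT (κ : Cardinal.{u}) (X : Type u) [TopologicalSpace X] : Prop :=
  ∀ (A : Set X) (p : X), p ∈ closure A → localTightness p A < κ

/-! The engine is a closing-off argument. Given a set of functions of support `< κ`, attach to each
finite `F ⊆ S` the supports `φ F` of countably many members that are dense in it over `F`. If `A` is
`φ`-closed, cutting a limit of the set down to `A` gives a limit of chosen members supported in `A`.

Corson implies tight: close off the support of the limit point. The closure has size `< κ`, so fewer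
than `κ` chosen members already accumulate at the point.

Conversely, let `f : C → K` be onto. Tightness makes the points of small support dense in every
fibre (`exists_mem_sigmaProduct_fibre`). Closing off pairs of such points gives `φ` such that
restriction to a `φ`-closed `A` preserves `C` and the kernel of `f`, hence descends to a map `R A`
of `K`, with `R univ = id`. By induction on `#A`, `R A` has a point-`< κ` separating family
(`hasSeparatingFamily_of_closedUnder`). For `#A < κ`, few Urysohn functions suffice. Otherwise `A`
is an increasing union of smaller closed sets, and differences along the chain are glued
(`HasSeparatingFamily.of_chain`). Each point of `K` lifts to small support, so it moves at fewer
than `κ` stages. The family for `univ` embeds `K`. -/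

open Set TopologicalSpace

/-! ### Closing off under finitary operations -/

section ClosingOff

variable {S : Type u}

/-- A set closed under a set-valued operation on finite sets. -/
def ClosedUnder (φ : Finset S → Set S) (A : Set S) : Prop :=
  ∀ F : Finset S, (F : Set S) ⊆ A → φ F ⊆ A

/-- One step towards the closure of a set under `φ`. -/
def closureStep (φ : Finset S → Set S) (B : Set S) : Set S :=
  B ∪ ⋃ F : Finset B, φ (F.map (Function.Embedding.subtype _))

/-- The least superset of `B` that is closed under `φ`. -/
def closureUnder (φ : Finset S → Set S) (B : Set S) : Set S :=
  ⋃ n : ℕ, (closureStep φ)^[n] B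

lemma subset_closureUnder (φ : Finset S → Set S) (B : Set S) : B ⊆ closureUnder φ B :=
  subset_iUnion_of_subset 0 subset_rfl

lemma ClosedUnder.univ (φ : Finset S → Set S) : ClosedUnder φ univ :=
  fun _ _ => subset_univ _

lemma exists_finset_subset_of_directed {ι : Type*} [Nonempty ι] {B : ι → Set S}
    (hB : Directed (· ⊆ ·) B) (F : Finset S) (hF : (F : Set S) ⊆ ⋃ i, B i) :
    ∃ i, (F : Set S) ⊆ B i := by
  simpa using hB.exists_mem_subset_of_finset_subset_biUnion hF

lemma ClosedUnder.iUnion {φ : Finset S → Set S} {ι : Type*} [Nonempty ι] {B : ι → Set S}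
    (hB : Directed (· ⊆ ·) B) (h : ∀ i, ClosedUnder φ (B i)) : ClosedUnder φ (⋃ i, B i) := by
  intro F hF
  obtain ⟨i, hi⟩ := exists_finset_subset_of_directed hB F hF
  exact (h i F hi).trans (subset_iUnion B i)

lemma subset_closureStep (φ : Finset S → Set S) (B : Set S) : B ⊆ closureStep φ B :=
  subset_union_left

lemma image_subset_closureStep {φ : Finset S → Set S} {B : Set S} {F : Finset S}
    (hF : (F : Set S) ⊆ B) : φ F ⊆ closureStep φ B := by
  classical
  refine subset_union_of_subset_right (subset_iUnion_of_subset
    (F.subtype (· ∈ B)) ?_) _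
  rw [Finset.subtype_map_of_mem (fun x hx => hF hx)]

lemma closedUnder_closureUnder (φ : Finset S → Set S) (B : Set S) :
    ClosedUnder φ (closureUnder φ B) := by
  intro F hF
  have hmono : Monotone fun n => (closureStep φ)^[n] B := by
    refine monotone_nat_of_le_succ fun n => ?_
    rw [Function.iterate_succ_apply']
    exact subset_closureStep φ _
  obtain ⟨n, hn⟩ := exists_finset_subset_of_directed hmono.directed_le F hF
  refine subset_iUnion_of_subset (n + 1) ?_
  rw [Function.iterate_succ_apply']
  exact image_subset_closureStep hn

lemma closureUnder_subset {φ : Finset S → Set S} {A B : Set S} (hA : ClosedUnder φ A)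
    (hBA : B ⊆ A) : closureUnder φ B ⊆ A := by
  refine iUnion_subset fun n => ?_
  induction n with
  | zero => exact hBA
  | succ n ih =>
    rw [Function.iterate_succ_apply']
    refine union_subset ih (iUnion_subset fun F => hA _ ?_)
    intro x hx
    simp only [Finset.coe_map, Function.Embedding.subtype_apply, mem_image] at hx
    obtain ⟨y, -, rfl⟩ := hx
    exact ih y.2

lemma closureUnder_mono (φ : Finset S → Set S) {A B : Set S} (h : A ⊆ B) :
    closureUnder φ A ⊆ closureUnder φ B :=
  closureUnder_subset (closedUnder_closureUnder φ B) (h.trans (subset_closureUnder φ B))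

lemma mk_finset_lt {κ : Cardinal.{u}} (hunc : ℵ₀ < κ) {α : Type u} (h : #α < κ) :
    #(Finset α) < κ := by
  rcases finite_or_infinite α with hα | hα
  · exact (Cardinal.lt_aleph0_of_finite _).trans hunc
  · rwa [mk_finset_of_infinite]

lemma mk_iUnion_countable_lt {κ : Cardinal.{u}} (hreg : κ.IsRegular) (hunc : ℵ₀ < κ)
    {ι : Type*} [Countable ι] {t : ι → Set S} (h : ∀ i, #(t i) < κ) : #(⋃ i, t i) < κ := by
  rcases isEmpty_or_nonempty ι with hι | hι
  · simpa using hreg.pos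
  obtain ⟨e, he⟩ := exists_surjective_nat ι
  rw [← he.iUnion_comp, ← (ULift.down_surjective : Function.Surjective
    (ULift.down : ULift.{u} ℕ → ℕ)).iUnion_comp]
  refine (card_iUnion_lt_iff_forall_of_isRegular hreg (by simpa using hunc)).2 fun i => h _

lemma mk_closureUnder_lt {κ : Cardinal.{u}} (hreg : κ.IsRegular) (hunc : ℵ₀ < κ)
    {φ : Finset S → Set S} (hφ : ∀ F, #(φ F) < κ) {B : Set S} (hB : #B < κ) :
    #(closureUnder φ B) < κ := by
  refine mk_iUnion_countable_lt hreg hunc fun n => ?_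
  induction n with
  | zero => exact hB
  | succ n ih =>
    rw [Function.iterate_succ_apply']
    refine (mk_union_le _ _).trans_lt (add_lt_of_lt hunc.le ih ?_)
    exact (card_iUnion_lt_iff_forall_of_isRegular hreg (mk_finset_lt hunc ih)).2 fun F => hφ _

/-- Here `μ` may be singular: if `κ ≤ #B`, the regular successor of `#B` replaces `κ`, and the
closure has size at most `#B`. -/
lemma mk_closureUnder_lt_of_le {κ μ : Cardinal.{u}} (hreg : κ.IsRegular) (hunc : ℵ₀ < κ)
    {φ : Finset S → Set S} (hφ : ∀ F, #(φ F) < κ) (hμ : κ ≤ μ) {B : Set S} (hB : #B < μ) :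
    #(closureUnder φ B) < μ := by
  rcases lt_or_ge #B κ with h | h
  · exact (mk_closureUnder_lt hreg hunc hφ h).trans_le hμ
  · refine (Order.lt_succ_iff.1 (mk_closureUnder_lt (isRegular_succ (hunc.le.trans h))
      (Order.lt_succ_of_le (hunc.le.trans h)) (fun F => ?_) (Order.lt_succ #B))).trans_lt hB
    exact Order.lt_succ_of_le ((hφ F).le.trans h)

end ClosingOff

/-! ### Approximation by functions supported in closed sets -/

section FunctionSpaces

variable {S : Type u} {E : Type*} [TopologicalSpace E]

lemma exists_countable_restrict_dense [SecondCountableTopology E] (Z : Set (S → E))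
    (F : Finset S) : ∃ N ⊆ Z, N.Countable ∧ F.restrict '' Z ⊆ closure (F.restrict '' N) := by
  obtain ⟨s, hs, hd⟩ := exists_countable_dense (F.restrict '' Z)
  obtain ⟨N, hNZ, hN⟩ : ∃ N ⊆ Z, InjOn F.restrict N ∧
      F.restrict '' N = Subtype.val '' s := by
    have := (Set.exists_subset_bijOn Z F.restrict)
    obtain ⟨Z', hZ', hb⟩ := this
    refine ⟨Z' ∩ F.restrict ⁻¹' (Subtype.val '' s), inter_subset_left.trans hZ',
      hb.injOn.mono inter_subset_left, ?_⟩
    rw [image_inter_preimage, hb.image_eq, inter_eq_right]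
    rintro _ ⟨y, -, rfl⟩
    exact y.2
  refine ⟨N, hNZ, ?_, ?_⟩
  · refine countable_of_injective_of_countable_image hN.1 ?_
    rw [hN.2]
    exact hs.image _
  · rw [hN.2]
    intro y hy
    exact image_closure_subset_closure_image continuous_subtype_val
      ⟨⟨y, hy⟩, hd _, rfl⟩

lemma mem_closure_of_finset_agree {u : S → E} {Z : Set (S → E)}
    (h : ∀ F : Finset S, ∃ z ∈ Z, ∀ s ∈ F, z s = u s) : u ∈ closure Z := by
  rw [mem_closure_iff]
  intro o ho hu
  obtain ⟨F, V, hV, hFV⟩ := isOpen_pi_iff.1 ho u hu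
  obtain ⟨z, hz, hzu⟩ := h F
  exact ⟨z, hFV fun s hs => by rw [hzu s hs]; exact (hV s hs).2, hz⟩

lemma indicator_mem_closure [Zero E] {T : Set S} {Z : Set (S → E)}
    (hZ : ∀ z ∈ Z, Function.support z ⊆ T) {x : S → E}
    (h : ∀ F : Finset S, (F : Set S) ⊆ T → F.restrict x ∈ closure (F.restrict '' Z)) :
    T.indicator x ∈ closure Z := by
  classical
  rw [mem_closure_iff]
  intro o ho hu
  obtain ⟨F, V, hV, hFV⟩ := isOpen_pi_iff.1 ho _ hu
  have hsub : ((F.filter (· ∈ T) : Finset S) : Set S) ⊆ T := fun s hs => by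
    simpa using (Finset.mem_filter.1 hs).2
  have hopen : IsOpen (univ.pi fun s : (F.filter (· ∈ T) : Finset S) => V s) :=
    isOpen_set_pi finite_univ fun s _ => (hV s (Finset.mem_filter.1 s.2).1).1
  obtain ⟨_, hzV, z, hz, rfl⟩ := mem_closure_iff.1 (h _ hsub) _ hopen fun s _ => by
    have := (hV s (Finset.mem_filter.1 s.2).1).2
    rwa [indicator_of_mem (hsub s.2)] at this
  refine ⟨z, hFV fun s hs => ?_, hz⟩
  by_cases hsT : s ∈ T
  · exact hzV ⟨s, Finset.mem_filter.2 ⟨hs, hsT⟩⟩ trivial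
  · have h0 : z s = 0 := by
      by_contra h0
      exact hsT (hZ z hz h0)
    have := (hV s hs).2
    rwa [indicator_of_notMem hsT, ← h0] at this

/-- Countable sets that are dense after restriction to finitely many coordinates, together with
an operation on finite sets that controls their supports. -/
lemma exists_closing_operation [SecondCountableTopology E] [Zero E] {κ : Cardinal.{u}}
    (hreg : κ.IsRegular) (hunc : ℵ₀ < κ) (Z : Set (S → E))
    (hZ : ∀ z ∈ Z, #(Function.support z) < κ) :
    ∃ (N : Finset S → Set (S → E)) (φ : Finset S → Set S), (∀ F, N F ⊆ Z) ∧
      (∀ F, (N F).Countable) ∧ (∀ F, F.restrict '' Z ⊆ closure (F.restrict '' N F)) ∧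
      (∀ F, ∀ z ∈ N F, Function.support z ⊆ φ F) ∧ ∀ F, #(φ F) < κ := by
  choose N hNZ hNc hNd using exists_countable_restrict_dense Z
  refine ⟨N, fun F => ⋃ z : N F, Function.support z.1, hNZ, hNc, hNd,
    fun F z hz => subset_iUnion (fun z : N F => Function.support z.1) ⟨z, hz⟩, fun F => ?_⟩
  have := (hNc F).to_subtype
  exact mk_iUnion_countable_lt hreg hunc fun z => hZ _ (hNZ F z.2)

/-- Closedness keeps the chosen members supported in `A`, so off `A` everything is 0. On a finite
part `F` of `A`, the members of `N F` suffice. -/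
lemma indicator_mem_closure_of_closedUnder [Zero E] {Z : Set (S → E)}
    {N : Finset S → Set (S → E)} {φ : Finset S → Set S}
    (hd : ∀ F : Finset S, F.restrict '' Z ⊆ closure (F.restrict '' N F))
    (hs : ∀ F, ∀ z ∈ N F, Function.support z ⊆ φ F) {A : Set S} (hA : ClosedUnder φ A)
    {x : S → E} (hx : x ∈ closure Z) :
    A.indicator x ∈ closure (⋃ F : {F : Finset S // (F : Set S) ⊆ A}, N F) := by
  refine indicator_mem_closure ?_ fun F hF => ?_
  · intro z hz
    obtain ⟨F, hF⟩ := mem_iUnion.1 hz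
    exact (hs _ _ hF).trans (hA _ F.2)
  · have h1 : F.restrict x ∈ closure (F.restrict '' Z) :=
      image_closure_subset_closure_image (by fun_prop) ⟨x, hx, rfl⟩
    refine closure_mono (image_mono ?_) (closure_minimal (hd F) isClosed_closure h1)
    exact subset_iUnion (fun F : {F : Finset S // (F : Set S) ⊆ A} => N F) ⟨F, hF⟩

end FunctionSpaces

/-! ### Corson compacta have small tightness -/

section Tightness

variable {κ : Cardinal.{u}}

lemma HasLocalTightnessLT.exists_subset {X : Type u} [TopologicalSpace X]
    (h : HasLocalTightnessLT κ X) {A : Set X} {p : X} (hp : p ∈ closure A) :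
    ∃ B ⊆ A, p ∈ closure B ∧ #B < κ := by
  have hne : ((fun B : Set X => #B) '' {B | B ⊆ A ∧ p ∈ closure B}).Nonempty :=
    ⟨_, A, ⟨subset_rfl, hp⟩, rfl⟩
  obtain ⟨B, ⟨hBA, hpB⟩, hB⟩ := csInf_mem hne
  exact ⟨B, hBA, hpB, hB.trans_lt (h A p hp)⟩

lemma hasLocalTightnessLT_of_exists_subset {X : Type u} [TopologicalSpace X]
    (h : ∀ (A : Set X) (p : X), p ∈ closure A → ∃ B ⊆ A, p ∈ closure B ∧ #B < κ) :
    HasLocalTightnessLT κ X := by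
  intro A p hp
  obtain ⟨B, hBA, hpB, hB⟩ := h A p hp
  have hmem : #B ∈ (fun B : Set X => #B) '' {B | B ⊆ A ∧ p ∈ closure B} :=
    ⟨B, ⟨hBA, hpB⟩, rfl⟩
  exact (csInf_le' hmem).trans_lt hB

lemma mk_finset_subset_lt (hunc : ℵ₀ < κ) {S : Type u} {T : Set S} (hT : #T < κ) :
    #{F : Finset S // (F : Set S) ⊆ T} < κ := by
  classical
  refine (mk_le_of_injective (f := fun F : {F : Finset S // (F : Set S) ⊆ T} =>
    F.1.subtype (· ∈ T)) ?_).trans_lt (mk_finset_lt hunc hT)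
  intro F F' h
  have := congrArg (Finset.map (Function.Embedding.subtype _)) h
  simp only [Finset.subtype_map_of_mem (fun x hx => F.2 hx),
    Finset.subtype_map_of_mem (fun x hx => F'.2 hx)] at this
  exact Subtype.ext this

theorem IsKappaCorson.hasLocalTightnessLT (hreg : κ.IsRegular) (hunc : ℵ₀ < κ) {K : Type u}
    [TopologicalSpace K] (hK : IsKappaCorson κ K) : HasLocalTightnessLT κ K := by
  obtain ⟨-, S, e, he⟩ := hK
  refine hasLocalTightnessLT_of_exists_subset fun A p hp => ?_
  have he' : IsEmbedding fun k => (e k : S → unitInterval) := IsEmbedding.subtypeVal.comp he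
  obtain ⟨N, φ, hNZ, hNc, hNd, hNs, hφ⟩ := exists_closing_operation hreg hunc
    ((fun k => (e k : S → unitInterval)) '' A) (by rintro _ ⟨k, -, rfl⟩; exact (e k).2)
  have hT := mk_closureUnder_lt hreg hunc hφ (e p).2
  have hpT := indicator_mem_closure_of_closedUnder hNd hNs
    (closedUnder_closureUnder φ (Function.support (e p).1))
    (image_closure_subset_closure_image he'.continuous ⟨p, hp, rfl⟩)
  -- The closed set contains the support of the limit point, so restriction leaves that point
  -- unchanged.
  rw [indicator_eq_self.2 (subset_closureUnder _ _)] at hpT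
  set W : Set (S → unitInterval) := ⋃ F : {F : Finset S //
    (F : Set S) ⊆ closureUnder φ (Function.support (e p).1)}, N F with hW
  have hWZ : W ⊆ (fun k => (e k : S → unitInterval)) '' A := iUnion_subset fun F => hNZ F
  have hWcard : #W < κ := by
    refine (card_iUnion_lt_iff_forall_of_isRegular hreg (mk_finset_subset_lt hunc hT)).2
      fun F => ?_
    exact (hNc F).le_aleph0.trans_lt hunc
  obtain ⟨B, hBA, hB⟩ := Set.subset_image_iff.1 hWZ
  refine ⟨B, hBA, ?_, ?_⟩
  · rw [he'.isInducing.closure_eq_preimage_closure_image, hB]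
    exact hpT
  · rw [← mk_image_eq he'.injective, hB]
    exact hWcard

end Tightness

/-! ### Dense fibres and descent of restrictions to the image -/

section Valdivia

variable {κ : Cardinal.{u}} {S K : Type u} {C : Set (S → unitInterval)}
  {f : C → K}

lemma support_subset_of_mem_closure {E : Type*} [TopologicalSpace E] [T1Space E] [Zero E]
    {B : Set (S → E)} {z : S → E} (hz : z ∈ closure B) :
    Function.support z ⊆ ⋃ b : B, Function.support b.1 := by
  intro s hs
  by_contra hsB
  refine hs ?_
  have hcl : IsClosed {x : S → E | x s = 0} := isClosed_singleton.preimage (continuous_apply s)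
  refine closure_minimal (fun b hb => ?_) hcl hz
  by_contra h0
  exact hsB (mem_iUnion.2 ⟨⟨b, hb⟩, h0⟩)

/-- Under a tightness assumption, the points of small support are dense in each fibre. -/
lemma exists_mem_sigmaProduct_fibre [TopologicalSpace K] [T2Space K] (hreg : κ.IsRegular) (hC : IsClosed C)
    (hD : Dense {x : C | (x : S → unitInterval) ∈ SigmaProduct κ S}) (hf : Continuous f)
    (hK : HasLocalTightnessLT κ K) (x : C) {U : Set C} (hU : U ∈ 𝓝 x) :
    ∃ z ∈ U, z.1 ∈ SigmaProduct κ S ∧ f z = f x := by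
  have : CompactSpace C := isCompact_iff_compactSpace.1 hC.isCompact
  obtain ⟨V, hVx, hVc, hVU⟩ := exists_mem_nhds_isClosed_subset hU
  have hx : x ∈ closure ({x : C | (x : S → unitInterval) ∈ SigmaProduct κ S} ∩ V) := by
    rw [mem_closure_iff_nhds]
    intro W hW
    obtain ⟨z, hz, hzD⟩ := mem_closure_iff_nhds.1 (hD x) _ (Filter.inter_mem hW hVx)
    exact ⟨z, hz.1, hzD, hz.2⟩
  obtain ⟨B, hBA, hpB, hB⟩ := hK.exists_subset
    (image_closure_subset_closure_image hf ⟨x, hx, rfl⟩)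
  -- One preimage per point of `B` keeps `#B' < κ`. By compactness the closure of `B'` maps onto a
  -- closed set containing `B`, and its points have support in a union of fewer than `κ` small
  -- supports.
  obtain ⟨B', hB', hbij⟩ := SurjOn.exists_bijOn_subset hBA
  have hcl : closure B ⊆ f '' closure B' :=
    closure_minimal (hbij.image_eq ▸ image_mono subset_closure)
      (isClosed_closure.isCompact.image hf).isClosed
  obtain ⟨z, hz, hzx⟩ := hcl hpB
  refine ⟨z, hVU (closure_minimal (hB'.trans inter_subset_right) hVc hz), ?_, hzx⟩
  have hz' := support_subset_of_mem_closure
    (image_closure_subset_closure_image continuous_subtype_val ⟨z, hz, rfl⟩)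
  refine (mk_le_mk_of_subset hz').trans_lt ?_
  refine (card_iUnion_lt_iff_forall_of_isRegular hreg ?_).2 ?_
  · refine mk_image_le.trans_lt ?_
    rwa [← mk_image_eq_of_injOn f B' hbij.injOn, hbij.image_eq]
  · rintro ⟨_, b, hb, rfl⟩
    exact (hB' hb).1

/-- The pairs of points of `C` identified by `f`, as functions on the index set. -/
def kernelPairs (f : C → K) : Set (S → unitInterval × unitInterval) :=
  {u | ∃ x y : C, f x = f y ∧ u = fun s => (x.1 s, y.1 s)}

lemma continuous_pairing :
    Continuous fun (p : C × C) (s : S) => ((p.1.1 s, p.2.1 s) : unitInterval × unitInterval) :=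
  continuous_pi fun s => ((continuous_apply s).comp (continuous_subtype_val.comp
    continuous_fst)).prodMk ((continuous_apply s).comp (continuous_subtype_val.comp
    continuous_snd))

lemma isClosed_kernelPairs [TopologicalSpace K] [T2Space K] (hC : IsClosed C) (hf : Continuous f) :
    IsClosed (kernelPairs f) := by
  have : CompactSpace C := isCompact_iff_compactSpace.1 hC.isCompact
  have h1 : IsClosed {p : C × C | f p.1 = f p.2} :=
    isClosed_eq (by fun_prop) (by fun_prop)
  convert (h1.isCompact.image continuous_pairing).isClosed using 1
  ext u
  simp only [kernelPairs, mem_ofPred_eq, mem_image, Prod.exists]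
  exact ⟨fun ⟨x, y, h, hu⟩ => ⟨x, y, h, hu.symm⟩, fun ⟨x, y, h, hu⟩ => ⟨x, y, h, hu.symm⟩⟩

lemma exists_of_indicator_mem_kernelPairs {A : Set S} {x y : S → unitInterval}
    (h : (A.indicator fun s => (x s, y s)) ∈ kernelPairs f) :
    ∃ x' y' : C, x'.1 = A.indicator x ∧ y'.1 = A.indicator y ∧ f x' = f y' := by
  obtain ⟨x', y', hxy, hu⟩ := h
  refine ⟨x', y', ?_, ?_, hxy⟩ <;> funext s <;> have hs := congrFun hu s <;>
    by_cases hsA : s ∈ A <;> simp only [hsA, indicator_of_mem, not_false_eq_true,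
      indicator_of_notMem, Prod.ext_iff, Prod.fst_zero, Prod.snd_zero] at hs ⊢
  exacts [hs.1.symm, hs.1.symm, hs.2.symm, hs.2.symm]

lemma indicator_mem_kernelPairs {A : Set S} {x y x' y' : C} (hx : x'.1 = A.indicator x.1)
    (hy : y'.1 = A.indicator y.1) (h : f x' = f y') :
    (A.indicator fun s => (x.1 s, y.1 s)) ∈ kernelPairs f := by
  refine ⟨x', y', h, ?_⟩
  funext s
  by_cases hsA : s ∈ A <;> simp [hx, hy, hsA, Prod.ext_iff]

/-- Fibrewise density makes pairs of small support dense in the kernel of `f`. Closing off pairs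
rather than points keeps restricted pairs limits of identified pairs, and the kernel is closed. -/
theorem exists_closing_operation_kernelPairs [TopologicalSpace K] [T2Space K] (hreg : κ.IsRegular) (hunc : ℵ₀ < κ)
    (hC : IsClosed C) (hf : Continuous f)
    (hfib : ∀ (x : C), ∀ U ∈ 𝓝 x, ∃ z ∈ U, z.1 ∈ SigmaProduct κ S ∧ f z = f x) :
    ∃ φ : Finset S → Set S, (∀ F, #(φ F) < κ) ∧ ∀ A, ClosedUnder φ A →
      ∀ x y : C, f x = f y →
        ∃ x' y' : C, x'.1 = A.indicator x.1 ∧ y'.1 = A.indicator y.1 ∧ f x' = f y' := by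
  set Q : Set (C × C) :=
    {p | p.1.1 ∈ SigmaProduct κ S ∧ p.2.1 ∈ SigmaProduct κ S ∧ f p.1 = f p.2} with hQ
  obtain ⟨N, φ, hNZ, -, hNd, hNs, hφ⟩ := exists_closing_operation hreg hunc
    ((fun (p : C × C) (s : S) => (p.1.1 s, p.2.1 s)) '' Q) (by
      rintro _ ⟨p, ⟨h1, h2, -⟩, rfl⟩
      rw [Function.support_prodMk]
      exact (mk_union_le _ _).trans_lt (add_lt_of_lt hreg.aleph0_le h1 h2))
  refine ⟨φ, hφ, fun A hA x y hxy => exists_of_indicator_mem_kernelPairs ?_⟩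
  have hmem : (x, y) ∈ closure Q := by
    rw [mem_closure_iff_nhds]
    intro W hW
    obtain ⟨U, hU, V, hV, hUV⟩ := mem_nhds_prod_iff.1 hW
    obtain ⟨z, hz, hzD, hzf⟩ := hfib x U hU
    obtain ⟨w, hw, hwD, hwf⟩ := hfib y V hV
    exact ⟨(z, w), hUV ⟨hz, hw⟩, hzD, hwD, by simp only [hzf, hwf, hxy]⟩
  have := indicator_mem_closure_of_closedUnder hNd hNs hA
    (image_closure_subset_closure_image continuous_pairing ⟨(x, y), hmem, rfl⟩)
  have hsub : ⋃ F : {F : Finset S // (F : Set S) ⊆ A}, N F ⊆ kernelPairs f := by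
    refine iUnion_subset fun F => (hNZ F.1).trans ?_
    rintro _ ⟨p, ⟨-, -, hp⟩, rfl⟩
    exact ⟨p.1, p.2, hp, rfl⟩
  exact closure_minimal hsub (isClosed_kernelPairs hC hf) this

/-- `R` is continuous and is induced through `f` by restricting points to the coordinates
in `A`. -/
structure InducedByRestriction [TopologicalSpace K] (f : C → K) (A : Set S) (R : K → K) : Prop where
  continuous : Continuous R
  exists_lift : ∀ x : C, ∃ x' : C, x'.1 = A.indicator x.1 ∧ f x' = R (f x)

lemma continuous_indicator_pi {E : Type*} [TopologicalSpace E] [Zero E] (A : Set S) :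
    Continuous fun x : S → E => A.indicator x := by
  refine continuous_pi fun s => ?_
  by_cases hs : s ∈ A
  · simpa [hs] using continuous_apply s
  · simpa [hs] using continuous_const

lemma exists_inducedByRestriction [TopologicalSpace K] [T2Space K] (hC : IsClosed C) (hf : Continuous f)
    (hsurj : Function.Surjective f) {A : Set S}
    (hA : ∀ x y : C, f x = f y →
      ∃ x' y' : C, x'.1 = A.indicator x.1 ∧ y'.1 = A.indicator y.1 ∧ f x' = f y') :
    ∃ R, InducedByRestriction f A R := by
  have : CompactSpace C := isCompact_iff_compactSpace.1 hC.isCompact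
  have hmem : ∀ x : C, A.indicator x.1 ∈ C := fun x => by
    obtain ⟨x', -, hx', -⟩ := hA x x rfl
    exact hx' ▸ x'.2
  let r : C → C := fun x => ⟨A.indicator x.1, hmem x⟩
  have hr : Continuous r :=
    ((continuous_indicator_pi A).comp continuous_subtype_val).subtype_mk _
  have hcomp : ∀ x, f (r (Function.surjInv hsurj (f x))) = f (r x) := fun x => by
    obtain ⟨y', x', hy', hx', h⟩ := hA _ x (Function.surjInv_eq hsurj (f x))
    have h1 : r (Function.surjInv hsurj (f x)) = y' := Subtype.ext hy'.symm
    have h2 : r x = x' := Subtype.ext hx'.symm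
    rw [h1, h2, h]
  refine ⟨fun k => f (r (Function.surjInv hsurj k)), ?_, fun x => ⟨r x, rfl, (hcomp x).symm⟩⟩
  -- A continuous surjection from a compact space onto a Hausdorff space is a quotient map, so
  -- continuity can be tested on `C`.
  rw [(hf.isClosedMap.isQuotientMap hf hsurj).continuous_iff]
  exact (hf.comp hr).congr fun x => (hcomp x).symm

end Valdivia

/-! ### Calculus of the induced maps -/

section InducedByRestriction

variable {κ : Cardinal.{u}} {S K : Type u} [TopologicalSpace K] {C : Set (S → unitInterval)}
  {f : C → K} {A B : Set S} {R R' : K → K}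

lemma InducedByRestriction.eq_of_indicator_eq (hR : InducedByRestriction f A R)
    (hR' : InducedByRestriction f B R') {x y : C} (h : A.indicator x.1 = B.indicator y.1) :
    R (f x) = R' (f y) := by
  obtain ⟨x', hx, hx'⟩ := hR.exists_lift x
  obtain ⟨y', hy, hy'⟩ := hR'.exists_lift y
  rw [← hx', ← hy', Subtype.ext (hx.trans (h.trans hy.symm))]

lemma InducedByRestriction.comp_eq_of_subset (hsurj : Function.Surjective f)
    (hR : InducedByRestriction f A R) (hR' : InducedByRestriction f B R') (hAB : A ⊆ B) (k : K) :
    R' (R k) = R k := by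
  obtain ⟨x, rfl⟩ := hsurj k
  obtain ⟨x', hx, hx'⟩ := hR.exists_lift x
  rw [← hx']
  refine (hR'.eq_of_indicator_eq hR (y := x) ?_).trans hx'.symm
  rw [hx, indicator_indicator, inter_eq_right.2 hAB]

lemma InducedByRestriction.apply_comp_of_subset (hsurj : Function.Surjective f)
    (hR' : InducedByRestriction f B R') (hR : InducedByRestriction f A R) (hAB : A ⊆ B) (k : K) :
    R (R' k) = R k := by
  obtain ⟨x, rfl⟩ := hsurj k
  obtain ⟨x', hx, hx'⟩ := hR'.exists_lift x
  rw [← hx']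
  refine hR.eq_of_indicator_eq hR ?_
  rw [hx, indicator_indicator, inter_eq_left.2 hAB]

lemma InducedByRestriction.eq_self (hsurj : Function.Surjective f)
    (hR : InducedByRestriction f univ R) (k : K) : R k = k := by
  obtain ⟨x, rfl⟩ := hsurj k
  obtain ⟨x', hx, hx'⟩ := hR.exists_lift x
  rw [← hx', Subtype.ext (hx.trans (indicator_univ _))]

/-- The restrictions of a pair to the `B i` accumulate at its restriction to the union, and the
kernel of `f` is closed. -/
lemma InducedByRestriction.eq_of_directed [T2Space K] (hC : IsClosed C) (hf : Continuous f)
    (hsurj : Function.Surjective f) {ι : Type*} [Nonempty ι] {B : ι → Set S}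
    (hB : Directed (· ⊆ ·) B) {T : ι → K → K} (hT : ∀ i, InducedByRestriction f (B i) (T i))
    (hR : InducedByRestriction f (⋃ i, B i) R) {k k' : K} (h : ∀ i, T i k = T i k') :
    R k = R k' := by
  obtain ⟨x, rfl⟩ := hsurj k
  obtain ⟨y, rfl⟩ := hsurj k'
  have hmem : ((⋃ i, B i).indicator fun s => (x.1 s, y.1 s)) ∈
      closure (range fun i => (B i).indicator fun s => (x.1 s, y.1 s)) := by
    classical
    refine mem_closure_of_finset_agree fun F => ?_
    obtain ⟨i, hi⟩ := exists_finset_subset_of_directed hB (F.filter (· ∈ ⋃ i, B i))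
      fun s hs => (Finset.mem_filter.1 hs).2
    refine ⟨_, ⟨i, rfl⟩, fun s hs => ?_⟩
    by_cases hsB : s ∈ ⋃ i, B i
    · have hsi : s ∈ B i := hi (Finset.mem_coe.2 (Finset.mem_filter.2 ⟨hs, hsB⟩))
      simp only [indicator_of_mem hsB, indicator_of_mem hsi]
    · have hsi : s ∉ B i := fun h => hsB (mem_iUnion.2 ⟨i, h⟩)
      simp only [indicator_of_notMem hsB, indicator_of_notMem hsi]
  have hsub : (range fun i => (B i).indicator fun s => (x.1 s, y.1 s)) ⊆ kernelPairs f := by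
    rintro _ ⟨i, rfl⟩
    obtain ⟨x', hx, hx'⟩ := (hT i).exists_lift x
    obtain ⟨y', hy, hy'⟩ := (hT i).exists_lift y
    exact indicator_mem_kernelPairs hx hy (by rw [hx', hy', h i])
  obtain ⟨x', y', hx, hy, hxy⟩ := exists_of_indicator_mem_kernelPairs
    (closure_minimal hsub (isClosed_kernelPairs hC hf) hmem)
  obtain ⟨x'', hx', hx''⟩ := hR.exists_lift x
  obtain ⟨y'', hy', hy''⟩ := hR.exists_lift y
  rw [← hx'', ← hy'', Subtype.ext (hx'.trans hx.symm), Subtype.ext (hy'.trans hy.symm), hxy]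

end InducedByRestriction

/-! ### Separating families by induction on cardinality -/

section SeparatingFamilies

/-- A point-`<κ` family of continuous functions that separates points exactly as `R` does. -/
def HasSeparatingFamily (κ : Cardinal.{u}) {K : Type u} [TopologicalSpace K] (R : K → K) : Prop :=
  ∃ (ι : Type u) (g : ι → K → ℝ), (∀ i, Continuous (g i)) ∧ (∀ i k, |g i k| ≤ 1) ∧
    (∀ k k', (∀ i, g i k = g i k') ↔ R k = R k') ∧ ∀ k, #{i | g i k ≠ 0} < κ

lemma exists_isTopologicalBasis_pi_mk_lt {κ : Cardinal.{u}} (hreg : κ.IsRegular)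
    (hunc : ℵ₀ < κ) {A : Type u} (hA : #A < κ) :
    ∃ 𝔅 : Set (Set (A → unitInterval)), IsTopologicalBasis 𝔅 ∧ #𝔅 < κ := by
  refine ⟨⋃ F : Finset A, (F.restrict ⁻¹' ·) '' countableBasis (F → unitInterval), ?_, ?_⟩
  · refine isTopologicalBasis_of_isOpen_of_nhds ?_ ?_
    · intro U hU
      obtain ⟨F, V, hV, rfl⟩ := mem_iUnion.1 hU
      exact (isOpen_of_mem_countableBasis hV).preimage (by fun_prop)
    · intro x U hxU hU
      obtain ⟨F, W, hW, hFW⟩ := isOpen_pi_iff.1 hU x hxU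
      have hopen : IsOpen (univ.pi fun s : {s // s ∈ F} => W s.1) :=
        isOpen_set_pi finite_univ fun s _ => (hW s.1 s.2).1
      obtain ⟨V, hV, hxV, hVW⟩ := (isBasis_countableBasis (F → unitInterval)).exists_subset_of_mem_open
        (show F.restrict x ∈ univ.pi fun s : {s // s ∈ F} => W s.1 from fun s _ => (hW s.1 s.2).2) hopen
      refine ⟨_, mem_iUnion.2 ⟨F, V, hV, rfl⟩, hxV, fun y hy => hFW fun s hs => ?_⟩
      exact hVW hy ⟨s, hs⟩ trivial
  · refine (card_iUnion_lt_iff_forall_of_isRegular hreg (mk_finset_lt hunc hA)).2 fun F => ?_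
    exact ((countable_countableBasis _).image _).le_aleph0.trans_lt hunc

/-- Take a Urysohn function for each disjoint pair of compact images `P U`, `P V`. Regularity of `Y`
makes the `P U` small enough to separate any two distinct values of `f`. -/
lemma exists_separating_of_basis {κ : Cardinal.{u}} (hκ : ℵ₀ ≤ κ) {X Y K : Type u}
    [TopologicalSpace X] [CompactSpace X] [TopologicalSpace Y] [RegularSpace Y]
    [TopologicalSpace K] [T2Space K] [NormalSpace K] {𝔅 : Set (Set Y)}
    (h𝔅 : IsTopologicalBasis 𝔅) (hcard : #𝔅 < κ) {ρ : X → Y} (hρ : IsInducing ρ) {f : X → K}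
    (hf : Continuous f) :
    ∃ (ι : Type u) (g : ι → K → ℝ), #ι < κ ∧ (∀ i, Continuous (g i)) ∧ (∀ i k, |g i k| ≤ 1) ∧
      ∀ x y, (∀ i, g i (f x) = g i (f y)) → f x = f y := by
  let P : Set Y → Set K := fun U => f '' (ρ ⁻¹' closure U)
  have hP : ∀ U, IsClosed (P U) := fun U =>
    ((isClosed_closure.preimage hρ.continuous).isCompact.image hf).isClosed
  choose g hg0 hg1 hg using fun p : {p : 𝔅 × 𝔅 // Disjoint (P p.1) (P p.2)} =>
    exists_continuous_zero_one_of_isClosed (hP p.1.1) (hP p.1.2) p.2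
  refine ⟨_, fun p k => g p k, ?_, fun p => (g p).continuous, fun p k => ?_, ?_⟩
  · refine (mk_subtype_le _).trans_lt ?_
    rw [← mul_def]
    exact mul_lt_of_lt hκ hcard hcard
  · exact abs_le.2 ⟨by linarith [(hg p k).1], (hg p k).2⟩
  · intro x y hxy
    by_contra hne
    obtain ⟨O, O', hO, hO', hxO, hyO', hdisj⟩ := t2_separation hne
    have key : ∀ x : X, ∀ O : Set K, IsOpen O → f x ∈ O → ∃ U ∈ 𝔅, f x ∈ P U ∧ P U ⊆ O := by
      intro x O hO hx
      have h1 : f ⁻¹' O ∈ 𝓝 x := hf.continuousAt (hO.mem_nhds hx)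
      rw [hρ.nhds_eq_comap] at h1
      obtain ⟨W, hW, hWO⟩ := h1
      obtain ⟨U, hU, hxU, hUW⟩ := h𝔅.exists_closure_subset hW
      refine ⟨U, hU, ⟨x, subset_closure hxU, rfl⟩, ?_⟩
      rintro _ ⟨z, hz, rfl⟩
      exact hWO (hUW hz)
    obtain ⟨U, hU, hxU, hUO⟩ := key x O hO hxO
    obtain ⟨V, hV, hyV, hVO⟩ := key y O' hO' hyO'
    have hpq : Disjoint (P U) (P V) := hdisj.mono hUO hVO
    have h := hxy ⟨(⟨U, hU⟩, ⟨V, hV⟩), hpq⟩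
    simp only at h
    rw [hg0 ⟨(⟨U, hU⟩, ⟨V, hV⟩), hpq⟩ hxU, hg1 ⟨(⟨U, hU⟩, ⟨V, hV⟩), hpq⟩ hyV] at h
    simp at h

variable {κ : Cardinal.{u}} {S K : Type u} [TopologicalSpace K] {C : Set (S → unitInterval)}
  {f : C → K}

/-- The values of `R` are images of points of `C` supported in `A`. These form a compact subspace of
`[0,1]^A`, which has a basis of size `< κ`. -/
lemma InducedByRestriction.hasSeparatingFamily [T2Space K] (hreg : κ.IsRegular) (hunc : ℵ₀ < κ)
    (hC : IsClosed C) (hf : Continuous f) (hsurj : Function.Surjective f) {A : Set S}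
    (hA : #A < κ) {R : K → K} (hR : InducedByRestriction f A R) : HasSeparatingFamily κ R := by
  have : CompactSpace C := isCompact_iff_compactSpace.1 hC.isCompact
  have : CompactSpace K := hsurj.compactSpace hf
  let X : Set C := {x | A.indicator x.1 = x.1}
  have hX : IsClosed X := isClosed_eq
    ((continuous_indicator_pi A).comp continuous_subtype_val) continuous_subtype_val
  have : CompactSpace X := isCompact_iff_compactSpace.1 hX.isCompact
  let ρ : X → (A → unitInterval) := fun x s => x.1.1 s
  have hρc : Continuous ρ := continuous_pi fun s =>
    (continuous_apply s.1).comp (continuous_subtype_val.comp continuous_subtype_val)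
  have hρi : Function.Injective ρ := by
    intro x y hxy
    refine Subtype.ext (Subtype.ext ?_)
    rw [← x.2, ← y.2]
    funext s
    by_cases hs : s ∈ A
    · simpa only [indicator_of_mem hs] using congrFun hxy ⟨s, hs⟩
    · simp only [indicator_of_notMem hs]
  obtain ⟨𝔅, h𝔅, hcard⟩ :=
    exists_isTopologicalBasis_pi_mk_lt hreg hunc hA
  obtain ⟨ι, g, hι, hgc, hg1, hsep⟩ := exists_separating_of_basis hunc.le h𝔅 hcard
    (hρc.isClosedEmbedding hρi).isInducing (hf.comp (continuous_subtype_val (p := (· ∈ X))))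
  refine ⟨ι, fun i k => g i (R k), fun i => (hgc i).comp hR.continuous, fun i k => hg1 i _,
    fun k k' => ⟨fun h => ?_, fun h i => congrArg (g i) h⟩, fun k => (mk_set_le _).trans_lt hι⟩
  have hlift : ∀ k, ∃ x : X, f x = R k := fun k => by
    obtain ⟨x, rfl⟩ := hsurj k
    obtain ⟨x', hx, hx'⟩ := hR.exists_lift x
    refine ⟨⟨x', ?_⟩, hx'⟩
    change A.indicator x'.1 = x'.1
    rw [hx, indicator_indicator, inter_self]
  obtain ⟨x, hx⟩ := hlift k
  obtain ⟨y, hy⟩ := hlift k'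
  rw [← hx, ← hy]
  exact hsep x y fun i => by simpa only [Function.comp_apply, hx, hy] using h i

/-- `P j` and `Q j` are the maps just before and just after stage `j`. Agreement below `j` gives `P
j k = P j k'`, so equal differences yield equal values of `g j`, and separation propagates by
transfinite induction. -/
lemma HasSeparatingFamily.of_chain (hreg : κ.IsRegular) {J : Type u} [LinearOrder J]
    [WellFoundedLT J] {P Q : J → K → K} {R₀ R : K → K} (h₀ : HasSeparatingFamily κ R₀)
    (hQ : ∀ j, HasSeparatingFamily κ (Q j)) (hP : ∀ j, Continuous (P j))
    (hQP : ∀ j k, Q j (P j k) = P j k) (hne : ∀ k, #{j | P j k ≠ Q j k} < κ)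
    (hlim : ∀ k k', R₀ k = R₀ k' → ∀ j, (∀ i < j, Q i k = Q i k') → P j k = P j k')
    (hend : ∀ k k', (∀ j, Q j k = Q j k') → R k = R k')
    (hR : ∀ k k', R k = R k' → R₀ k = R₀ k' ∧ ∀ j, P j k = P j k' ∧ Q j k = Q j k') :
    HasSeparatingFamily κ R := by
  obtain ⟨ι₀, g₀, hc₀, hb₀, hs₀, hκ₀⟩ := h₀
  choose ι g hc hb hs hκ using hQ
  -- Halving keeps the differences bounded by 1.
  refine ⟨ι₀ ⊕ Σ j, ι j, Sum.elim g₀ fun p k => (g p.1 p.2 k - g p.1 p.2 (P p.1 k)) / 2,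
    ?_, ?_, ?_, ?_⟩
  · rintro (i | ⟨j, i⟩)
    · exact hc₀ i
    · exact ((hc j i).sub ((hc j i).comp (hP j))).div_const 2
  · rintro (i | ⟨j, i⟩) k
    · exact hb₀ i k
    · have h1 := abs_le.1 (hb j i k)
      have h2 := abs_le.1 (hb j i (P j k))
      simp only [Sum.elim_inr]
      exact abs_le.2 ⟨by linarith, by linarith⟩
  · intro k k'
    constructor
    · intro h
      have h0 : R₀ k = R₀ k' := (hs₀ k k').1 fun i => h (Sum.inl i)
      refine hend k k' fun j => ?_
      induction j using WellFoundedLT.induction with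
      | _ j ih =>
        refine (hs j k k').1 fun i => ?_
        have h1 := h (Sum.inr ⟨j, i⟩)
        simp only [Sum.elim_inr, hlim k k' h0 j ih] at h1
        linarith
    · intro h
      obtain ⟨h0, h1⟩ := hR k k' h
      rintro (i | ⟨j, i⟩)
      · exact (hs₀ k k').2 h0 i
      · simp only [Sum.elim_inr, (h1 j).1, (hs j k k').2 (h1 j).2 i]
  · intro k
    have hsub : {i | Sum.elim g₀
          (fun (p : Σ j, ι j) k => (g p.1 p.2 k - g p.1 p.2 (P p.1 k)) / 2) i k ≠ 0} ⊆
        Sum.inl '' {i | g₀ i k ≠ 0} ∪ ⋃ j : {j | P j k ≠ Q j k},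
          (fun i => Sum.inr ⟨j, i⟩) '' ({i | g j i k ≠ 0} ∪ {i | g j i (P j k) ≠ 0}) := by
      rintro (i | ⟨j, i⟩) hi
      · exact Or.inl ⟨i, hi, rfl⟩
      · have hi' : (g j i k - g j i (P j k)) / 2 ≠ 0 := hi
        refine Or.inr (mem_iUnion.2 ⟨⟨j, fun hPQ => hi' ?_⟩, i, ?_, rfl⟩)
        -- If stage `j` does not move `k`, then `Q j` agrees at `k` and `P j k`, so all differences
        -- at that stage vanish.
        · rw [(hs j k (P j k)).2 (by rw [hQP, hPQ]) i, sub_self, zero_div]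
        · by_contra hcon
          have h1 : g j i k = 0 := by
            by_contra h1
            exact hcon (Or.inl h1)
          have h2 : g j i (P j k) = 0 := by
            by_contra h2
            exact hcon (Or.inr h2)
          exact hi' (by rw [h1, h2, sub_self, zero_div])
    refine (mk_le_mk_of_subset hsub).trans_lt ((mk_union_le _ _).trans_lt
      (add_lt_of_lt hreg.aleph0_le (mk_image_le.trans_lt (hκ₀ k)) ?_))
    refine (card_iUnion_lt_iff_forall_of_isRegular hreg (hne k)).2 fun j => ?_
    exact mk_image_le.trans_lt ((mk_union_le _ _).trans_lt
      (add_lt_of_lt hreg.aleph0_le (hκ _ _) (hκ _ _)))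

lemma closureUnder_image_Iio {J : Type*} [LinearOrder J] (φ : Finset S → Set S) (v : J → S)
    (j : J) [Nonempty (Iio j)] :
    closureUnder φ (v '' Iio j) = ⋃ i : Iio j, closureUnder φ (v '' Iic i.1) := by
  have hdir : Directed (· ⊆ ·) fun i : Iio j => closureUnder φ (v '' Iic i.1) :=
    Monotone.directed_le fun i i' h => closureUnder_mono φ (image_mono (Iic_subset_Iic.2 h))
  refine subset_antisymm (closureUnder_subset
    (ClosedUnder.iUnion hdir fun i => closedUnder_closureUnder φ _) ?_) (iUnion_subset fun i => ?_)
  · rintro _ ⟨i, hi, rfl⟩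
    exact mem_iUnion.2 ⟨⟨i, hi⟩, subset_closureUnder φ _ ⟨i, self_mem_Iic, rfl⟩⟩
  · exact closureUnder_mono φ (image_mono (Iic_subset_Iio.2 i.2))

/-- The layers `V j \ U j` are pairwise disjoint, and each counted `j` has a support point of `x` in
its layer. -/
lemma mk_indicator_ne_lt {J : Type u} [LinearOrder J] {U V : J → Set S}
    (hUV : ∀ j, U j ⊆ V j) (hVU : ∀ i j, i < j → V i ⊆ U j) {x : S → unitInterval}
    (hx : x ∈ SigmaProduct κ S) :
    #{j | (U j).indicator x ≠ (V j).indicator x} < κ := by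
  have key : ∀ j : {j | (U j).indicator x ≠ (V j).indicator x},
      ∃ s : Function.support x, s.1 ∈ V j ∧ s.1 ∉ U j := by
    rintro ⟨j, hj⟩
    obtain ⟨s, hs⟩ := Function.ne_iff.1 hj
    by_cases hsU : s ∈ U j
    · rw [indicator_of_mem hsU, indicator_of_mem (hUV j hsU)] at hs
      exact absurd rfl hs
    · by_cases hsV : s ∈ V j
      · rw [indicator_of_notMem hsU, indicator_of_mem hsV] at hs
        exact ⟨⟨s, hs.symm⟩, hsV, hsU⟩
      · rw [indicator_of_notMem hsU, indicator_of_notMem hsV] at hs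
        exact absurd rfl hs
  choose s hsV hsU using key
  refine (mk_le_of_injective (f := s) fun i j hij => ?_).trans_lt hx
  rcases lt_trichotomy i.1 j.1 with h | h | h
  · exact absurd (hij ▸ hVU _ _ h (hsV i)) (hsU j)
  · exact Subtype.ext h
  · exact absurd (hij ▸ hVU _ _ h (hsV j)) (hsU i)

theorem hasSeparatingFamily_of_closedUnder [T2Space K] (hreg : κ.IsRegular) (hunc : ℵ₀ < κ)
    (hC : IsClosed C) (hf : Continuous f) (hsurj : Function.Surjective f)
    (hD : ∀ k, ∃ x : C, x.1 ∈ SigmaProduct κ S ∧ f x = k) {φ : Finset S → Set S}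
    (hφ : ∀ F, #(φ F) < κ) {R : Set S → K → K}
    (hR : ∀ A, ClosedUnder φ A → InducedByRestriction f A (R A)) (A : Set S)
    (hA : ClosedUnder φ A) : HasSeparatingFamily κ (R A) := by
  induction hμ : #A using WellFoundedLT.induction generalizing A with
  | _ μ ih =>
  subst hμ
  rcases lt_or_ge #A κ with hlt | hle
  · exact (hR A hA).hasSeparatingFamily hreg hunc hC hf hsurj hlt
  have hcl : ∀ B, InducedByRestriction f (closureUnder φ B) (R (closureUnder φ B)) :=
    fun B => hR _ (closedUnder_closureUnder φ B)
  have hih : ∀ B : Set S, #B < #A → HasSeparatingFamily κ (R (closureUnder φ B)) :=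
    fun B hB => ih _ (mk_closureUnder_lt_of_le hreg hunc hφ hle hB) _
      (closedUnder_closureUnder φ B) rfl
  -- The well-order has the least possible order type, so proper initial segments have size `< #A`
  -- and the induction hypothesis applies to their closures.
  obtain ⟨_, _, hord⟩ := exists_ord_eq_type_lt A
  have hvA : ∀ s : Set A, Subtype.val '' s ⊆ A := fun s => Subtype.coe_image_subset _ _
  have hIic : ∀ j : A, #(Subtype.val '' Iic j : Set S) < #A := fun j => by
    refine mk_image_le.trans_lt ?_
    rw [← Iio_insert]
    exact (mk_insert_le).trans_lt (add_lt_of_lt (hunc.le.trans hle) (mk_Iio_lt j hord)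
      (one_lt_aleph0.trans_le (hunc.le.trans hle)))
  have hsub : ∀ j : A, closureUnder φ (Subtype.val '' Iio j) ⊆
      closureUnder φ (Subtype.val '' Iic j) :=
    fun j => closureUnder_mono φ (image_mono Iio_subset_Iic_self)
  have hne : Nonempty A := mk_ne_zero_iff.1 (hreg.pos.trans_le hle).ne'
  have hdir : Directed (· ⊆ ·) fun i : A => closureUnder φ (Subtype.val '' Iic i) :=
    Monotone.directed_le fun i i' h => closureUnder_mono φ (image_mono (Iic_subset_Iic.2 h))
  have hAU : A = ⋃ i : A, closureUnder φ (Subtype.val '' Iic i) := by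
    refine subset_antisymm (fun s hs => ?_)
      (iUnion_subset fun i => closureUnder_subset hA (hvA _))
    exact mem_iUnion.2 ⟨⟨s, hs⟩, subset_closureUnder φ _ ⟨⟨s, hs⟩, self_mem_Iic, rfl⟩⟩
  have hdown : ∀ B ⊆ A, ∀ k k', R A k = R A k' →
      R (closureUnder φ B) k = R (closureUnder φ B) k' := fun B hB k k' h => by
    rw [← (hR A hA).apply_comp_of_subset hsurj (hcl B) (closureUnder_subset hA hB) k, h,
      (hR A hA).apply_comp_of_subset hsurj (hcl B) (closureUnder_subset hA hB) k']
  refine HasSeparatingFamily.of_chain hreg (J := A)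
    (R₀ := R (closureUnder φ ∅)) (P := fun j => R (closureUnder φ (Subtype.val '' Iio j)))
    (Q := fun j => R (closureUnder φ (Subtype.val '' Iic j)))
    (hih ∅ (by simpa using hreg.pos.trans_le hle))
    (fun j => hih _ (hIic j)) (fun j => (hcl _).continuous)
    (fun j k => (hcl _).comp_eq_of_subset hsurj (hcl _) (hsub j) k) ?_ ?_ ?_ ?_
  · intro k
    obtain ⟨x, hx, rfl⟩ := hD k
    refine (mk_le_mk_of_subset fun j hj => ?_).trans_lt (mk_indicator_ne_lt hsub
      (fun i j hij => closureUnder_mono φ (image_mono (Iic_subset_Iio.2 hij))) hx)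
    exact fun h => hj ((hcl _).eq_of_indicator_eq (hcl _) h)
  · intro k k' h0 j hj
    -- At the least `j`, `P j` is `R₀` itself. The closure of `∅` contains `φ ∅`, so `R₀` need not
    -- be constant and requires its own family.
    rcases isEmpty_or_nonempty (Iio j) with he | he
    · simpa only [isEmpty_coe_sort.1 he, image_empty] using h0
    · have hdir' : Directed (· ⊆ ·)
          fun i : Iio j => closureUnder φ (Subtype.val '' Iic i.1) :=
        Monotone.directed_le fun i i' h => closureUnder_mono φ (image_mono (Iic_subset_Iic.2 h))
      have hj' := hcl (Subtype.val '' Iio j)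
      refine InducedByRestriction.eq_of_directed hC hf hsurj hdir' (fun i => hcl _) ?_
        fun i => hj i.1 i.2
      rw [← closureUnder_image_Iio φ Subtype.val j]
      exact hj'
  · intro k k' h
    exact InducedByRestriction.eq_of_directed hC hf hsurj hdir (fun i => hcl _)
      (hAU ▸ hR A hA) h
  · exact fun k k' h => ⟨hdown _ (empty_subset _) k k' h,
      fun j => ⟨hdown _ (hvA _) k k' h, hdown _ (hvA _) k k' h⟩⟩

/-- Each real function is recorded by its positive and negative parts, which take values in `[0,1]`
and vanish where it does. -/
theorem HasSeparatingFamily.isKappaCorson [CompactSpace K] {R : K → K}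
    (hκ : ℵ₀ ≤ κ) (h : HasSeparatingFamily κ R) (hR : Function.Injective R) :
    IsKappaCorson κ K := by
  obtain ⟨ι, g, hc, hb, hs, hcard⟩ := h
  let e : K → ι ⊕ ι → unitInterval := fun k => Sum.elim
    (fun i => projIcc 0 1 zero_le_one (g i k)) (fun i => projIcc 0 1 zero_le_one (-g i k))
  have hec : Continuous e := by
    refine continuous_pi ?_
    rintro (i | i)
    · exact continuous_projIcc.comp (hc i)
    · exact continuous_projIcc.comp (hc i).neg
  have hei : Function.Injective e := by
    intro k k' h
    refine hR ((hs k k').1 fun i => ?_)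
    have h1 := congrArg Subtype.val (congrFun h (Sum.inl i))
    have h2 := congrArg Subtype.val (congrFun h (Sum.inr i))
    have hk := abs_le.1 (hb i k)
    have hk' := abs_le.1 (hb i k')
    simp only [e, Sum.elim_inl, Sum.elim_inr, coe_projIcc] at h1 h2
    rw [min_eq_right hk.2, min_eq_right hk'.2] at h1
    rw [min_eq_right (by linarith), min_eq_right (by linarith)] at h2
    rcases max_cases 0 (g i k) with h3 | h3 <;> rcases max_cases 0 (g i k') with h4 | h4 <;>
      rcases max_cases 0 (-g i k) with h5 | h5 <;> rcases max_cases 0 (-g i k') with h6 | h6 <;>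
      linarith
  have hemem : ∀ k, e k ∈ SigmaProduct κ (ι ⊕ ι) := by
    intro k
    have hsub : Function.support (e k) ⊆
        Sum.inl '' {i | g i k ≠ 0} ∪ Sum.inr '' {i | g i k ≠ 0} := by
      rintro (i | i) hi
      · refine Or.inl ⟨i, fun h0 => hi ?_, rfl⟩
        simp [e, h0]
      · refine Or.inr ⟨i, fun h0 => hi ?_, rfl⟩
        simp [e, h0]
    exact (mk_le_mk_of_subset hsub).trans_lt ((mk_union_le _ _).trans_lt
      (add_lt_of_lt hκ (mk_image_le.trans_lt (hcard k)) (mk_image_le.trans_lt (hcard k))))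
  exact ⟨inferInstance, ι ⊕ ι, fun k => ⟨e k, hemem k⟩,
    ((hec.subtype_mk hemem).isClosedEmbedding
      fun k k' h => hei (congrArg Subtype.val h)).isEmbedding⟩

end SeparatingFamilies

/-! ### The equivalence -/

theorem mainTheorem5 (κ : Cardinal.{u}) (hreg : κ.IsRegular) (hunc : ℵ₀ < κ)
    (L K : Type u) [TopologicalSpace L] [TopologicalSpace K] [T2Space K]
    (hL : IsKappaValdivia κ L) (f : L → K) (hf : Continuous f) (hsurj : Function.Surjective f) :
    IsKappaCorson κ K ↔ HasLocalTightnessLT κ K := by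
  refine ⟨fun h => h.hasLocalTightnessLT hreg hunc, fun hK => ?_⟩
  obtain ⟨S, C, hC, hD, ⟨e⟩⟩ := hL
  have : CompactSpace C := isCompact_iff_compactSpace.1 hC.isCompact
  have hg : Continuous (f ∘ e.symm) := hf.comp e.symm.continuous
  have hgs : Function.Surjective (f ∘ e.symm) := hsurj.comp e.symm.surjective
  have : CompactSpace K := hgs.compactSpace hg
  have hfib : ∀ (x : C), ∀ U ∈ 𝓝 x, ∃ z ∈ U, z.1 ∈ SigmaProduct κ S ∧
      (f ∘ e.symm) z = (f ∘ e.symm) x :=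
    fun x U hU => exists_mem_sigmaProduct_fibre hreg hC hD hg hK x hU
  obtain ⟨φ, hφ, hpair⟩ := exists_closing_operation_kernelPairs hreg hunc hC hg hfib
  have hex : ∀ A, ∃ R, ClosedUnder φ A → InducedByRestriction (f ∘ e.symm) A R := by
    intro A
    by_cases hA : ClosedUnder φ A
    · obtain ⟨R, hR⟩ := exists_inducedByRestriction hC hg hgs (hpair A hA)
      exact ⟨R, fun _ => hR⟩
    · exact ⟨id, fun h => absurd h hA⟩
  choose R hR using hex
  have hDsurj : ∀ k, ∃ x : C, x.1 ∈ SigmaProduct κ S ∧ (f ∘ e.symm) x = k := fun k => by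
    obtain ⟨x, rfl⟩ := hgs k
    obtain ⟨z, -, hz, hzx⟩ := hfib x _ Filter.univ_mem
    exact ⟨z, hz, hzx⟩
  have huniv := hR univ (ClosedUnder.univ φ)
  refine (hasSeparatingFamily_of_closedUnder hreg hunc hC hg hgs hDsurj hφ hR univ
    (ClosedUnder.univ φ)).isKappaCorson hunc.le fun k k' h => ?_
  rwa [huniv.eq_self hgs, huniv.eq_self hgs] at h
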